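/- For every integer $m\ge 1$, let $\mathrm B^{\rm pol}_{\mathbb C,m}$ denote the best (smallest) constant $D$ in the polynomial Bohnenblust--Hille inequality, i.e. the smallest real number $D$ such that for every $n\ge 1$ and every $m$-homogeneous polynomial $P(z)=\sum_{|\alpha|=m}a_\alpha z^\alpha$ on $\mathbb C^n$, $$\Big(\sum_{|\alpha|=m}|a_\alpha|^{\frac{2m}{m+1}}\Big)^{\frac{m+1}{2m}}\le D\,\sup_{z\in\mathbb D^n}|P(z)|,$$ where $\mathbb D$ is the open unit disk of $\mathbb C$. Such a smallest constant exists for every $m\ge 1$, and for every $\varepsilon>0$ there exists $\kappa>0$ such that, for every $m\ge 1$, $$\mathrm B^{\rm pol}_{\mathbb C,m}\le\kappa(1+\varepsilon)^m .$$ -/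

import Mathlib

namespace BohnenblustHille

/-- The supremum norm `sup_{z ∈ 𝔻ⁿ} |P(z)|` of a complex polynomial in `n` variables
over the open unit polydisk. -/
noncomputable def polydiskNorm {n : ℕ} (P : MvPolynomial (Fin n) ℂ) : ℝ :=
  sSup ((fun z : Fin n → ℂ => ‖MvPolynomial.eval z P‖) '' {z | ∀ i, ‖z i‖ < 1})

/-- The supremum in `polydiskNorm` is over a bounded set. -/
theorem bddAbove_polydisk {n : ℕ} (P : MvPolynomial (Fin n) ℂ) :
    BddAbove ((fun z : Fin n → ℂ => ‖MvPolynomial.eval z P‖) '' {z | ∀ i, ‖z i‖ < 1}) := by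
  have hc : Continuous (fun z : Fin n → ℂ => ‖MvPolynomial.eval z P‖) :=
    (MvPolynomial.continuous_eval P).norm
  have hK : IsCompact (Metric.closedBall (0 : Fin n → ℂ) 1) := isCompact_closedBall 0 1
  refine (hK.bddAbove_image hc.continuousOn).mono (Set.image_mono ?_)
  intro z hz
  rw [mem_closedBall_zero_iff]
  exact (pi_norm_le_iff_of_nonneg zero_le_one).2 fun i => (hz i).le

/-- The norm `(∑_{|α| = m} |a_α| ^ (2m/(m+1))) ^ ((m+1)/(2m))` of the coefficients of degree `m`
of a complex polynomial in `n` variables. -/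
noncomputable def coeffNorm {n : ℕ} (m : ℕ) (P : MvPolynomial (Fin n) ℂ) : ℝ :=
  (∑ α ∈ Finset.finsuppAntidiag (Finset.univ : Finset (Fin n)) m,
    ‖MvPolynomial.coeff α P‖ ^ (2 * (m : ℝ) / ((m : ℝ) + 1))) ^ (((m : ℝ) + 1) / (2 * (m : ℝ)))

/-- The constants `D` for which the polynomial Bohnenblust-Hille inequality of degree `m` holds
for every number `n ≥ 1` of variables and every `m`-homogeneous complex polynomial. -/
def polConstants (m : ℕ) : Set ℝ :=
  {D | ∀ n : ℕ, 1 ≤ n → ∀ P : MvPolynomial (Fin n) ℂ, P.IsHomogeneous m →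
    coeffNorm m P ≤ D * polydiskNorm P}

/-- The best constant in the polynomial Bohnenblust-Hille inequality of degree `m`
over the complex numbers. -/
noncomputable def bPol (m : ℕ) : ℝ := sInf (polConstants m)

end BohnenblustHille

/-!
The best constant in degree `m` is bounded recursively, through constants of smaller degrees.
Write `m` as the sum of block lengths `κ_b` and group the `m` indices of a monomial accordingly. A
Blei-type inequality (`sum_piFinset_rpow_le_prod`, `sum_coeff_rpow_le_prod`) bounds the
`ℓ^{2m/(m+1)}` norm of the coefficients by the mixed norms that are `ℓ^{2κ_b/(κ_b+1)}` in the
block `b` and `ℓ²` in the other indices. Since the blocks form a partition, no Loomis-Whitney type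
inequality is needed: Hölder's inequality and a factorization of sums suffice. The multiplicities
of monomials cause no loss, because each coefficient is spread evenly over its decompositions into
blocks.

The inner `ℓ²` norm for a fixed multi-index `γ` of degree `k = κ_b` is at most the `L²` norm, over
the torus, of the Hasse derivative of `P` of index `γ` (`sum_block_rpow_le`). A homogeneous
polynomial of degree `d` satisfies `‖Q‖₄ ≤ 2^{d/2} ‖Q‖₂` by counting decompositions, whence
`‖Q‖₂ ≤ 2^{d/k} ‖Q‖_{2k/(k+1)}` by interpolation (`sum_norm_sq_rpow_le`). At each point `z` of the torus
the Hasse derivatives of order `k` are the coefficients of the part of degree `k` of the Taylor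
expansion of `P` at `z`, which is at most `e m^k ‖P‖` on the polydisk (`norm_sum_hasse_le`); the
Bohnenblust-Hille inequality of degree `k` applies to it. Averages over the torus are taken over a
finite grid of roots of unity, fine enough for the degrees in question.

This gives `2^{m/κ_b} D_{κ_b} e m^{κ_b}`, maximized over `b`, as a constant for the degree `m`
(`mem_polConstants_of_blocks`), where `D_κ` is any constant for the degree `κ`. Blocks of length
one show that some constant exists in every degree. Blocks with lengths in `[k, 2k)` give
`C_k m^{2k} 2^{m/k}` (`bPol_le_of_block_length`), which is less than a multiple of `(1 + ε)^m` once
`2^{1/k} < 1 + ε`.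
-/

namespace BohnenblustHille

open Finset

/-! ### Hölder's inequality and mixed norms over blocks of indices -/

/-- Hölder's inequality for finitely many factors, with weights `w` of sum one. -/
theorem sum_prod_rpow_le {ι X : Type*} (s : Finset ι) (t : Finset X) (w : ι → ℝ)
    (y : ι → X → ℝ) (hw : ∀ j ∈ s, 0 < w j) (hw1 : ∑ j ∈ s, w j = 1)
    (hy : ∀ j ∈ s, ∀ x ∈ t, 0 ≤ y j x) :
    ∑ x ∈ t, ∏ j ∈ s, y j x ^ w j ≤ ∏ j ∈ s, (∑ x ∈ t, y j x) ^ w j := by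
  have hS0 : ∀ j ∈ s, 0 ≤ ∑ x ∈ t, y j x := fun j hj => sum_nonneg (hy j hj)
  by_cases h0 : ∃ j ∈ s, ∑ x ∈ t, y j x = 0
  · obtain ⟨j, hj, h⟩ := h0
    have hz := (sum_eq_zero_iff_of_nonneg (hy j hj)).1 h
    have : ∑ x ∈ t, ∏ j ∈ s, y j x ^ w j = 0 := sum_eq_zero fun x hx =>
      prod_eq_zero hj (by rw [hz x hx, Real.zero_rpow (hw j hj).ne'])
    rw [this]
    exact prod_nonneg fun i hi => Real.rpow_nonneg (hS0 i hi) _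
  · push Not at h0
    have hpos : ∀ j ∈ s, 0 < ∑ x ∈ t, y j x := fun j hj => lt_of_le_of_ne (hS0 j hj) (h0 j hj).symm
    have hP : 0 < ∏ j ∈ s, (∑ x ∈ t, y j x) ^ w j :=
      prod_pos fun j hj => Real.rpow_pos_of_pos (hpos j hj) _
    have key : ∀ x ∈ t, ∏ j ∈ s, y j x ^ w j ≤
        (∏ j ∈ s, (∑ x ∈ t, y j x) ^ w j) * ∑ j ∈ s, w j * (y j x / ∑ x ∈ t, y j x) := by
      intro x hx
      have := Real.geom_mean_le_arith_mean_weighted s w (fun j => y j x / ∑ x ∈ t, y j x)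
        (fun j hj => (hw j hj).le) hw1 (fun j hj => div_nonneg (hy j hj x hx) (hS0 j hj))
      refine le_trans (le_of_eq ?_) (mul_le_mul_of_nonneg_left this hP.le)
      rw [← prod_mul_distrib]
      refine prod_congr rfl fun j hj => ?_
      rw [← Real.mul_rpow (hS0 j hj) (div_nonneg (hy j hj x hx) (hS0 j hj)),
        mul_div_cancel₀ _ (h0 j hj)]
    refine (sum_le_sum key).trans (le_of_eq ?_)
    rw [← mul_sum, sum_comm]
    have : ∀ j ∈ s, ∑ x ∈ t, w j * (y j x / ∑ x ∈ t, y j x) = w j := by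
      intro j hj
      rw [← mul_sum, ← sum_div, div_self (h0 j hj), mul_one]
    rw [sum_congr rfl this, hw1, mul_one]

/-- A Blei-type inequality. Split an array into blocks `b` of length `κ b`, with total length `m`.
The `ℓ^{2m/(m+1)}` norm of the array is controlled by its mixed norms: `ℓ²` in all blocks but `b`,
and `ℓ^{2κ/(κ+1)}`, where `κ = κ b`, in the block `b`. Here `Λ b v` bounds the square of the inner
`ℓ²` norm. With `f_b = Λ_b^{1/2}`, the proof writes `a^{2m/(m+1)}` as the product of the factors
`(a² f_b^{-2/(κ+1)})^{κ/(m+1)}` over all `b`, and of `(∏_b f_b^{2κ/(κ+1)})^{1/(m+1)}`, and applies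
Hölder's inequality; the blocks are disjoint, so that the sum of the last product factorizes. -/
theorem sum_piFinset_rpow_le_prod {ι V : Type*} [Fintype ι] [DecidableEq ι] [DecidableEq V]
    (G : ι → Finset V) (κ : ι → ℕ) (hκ : ∀ b, 1 ≤ κ b) (m : ℕ) (hm : ∑ b, κ b = m) (a : (ι → V) → ℝ)
    (ha : ∀ x, 0 ≤ a x) (Λ : ι → V → ℝ)
    (hΛ : ∀ b, ∀ v ∈ G b, ∑ x ∈ Fintype.piFinset G with x b = v, a x ^ 2 ≤ Λ b v) :
    ∑ x ∈ Fintype.piFinset G, a x ^ (2 * (m : ℝ) / ((m : ℝ) + 1)) ≤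
      ∏ b, (∑ v ∈ G b, Λ b v ^ ((κ b : ℝ) / ((κ b : ℝ) + 1))) ^
        (((κ b : ℝ) + 1) / ((m : ℝ) + 1)) := by
  have hΛ0 : ∀ b, ∀ v ∈ G b, 0 ≤ Λ b v := fun b v hv =>
    (sum_nonneg fun x _ => sq_nonneg (a x)).trans (hΛ b v hv)
  have hmR : (∑ b, (κ b : ℝ)) = m := by exact_mod_cast hm
  have hκ0 : ∀ b, (0 : ℝ) < κ b := fun b => by exact_mod_cast hκ b
  have hm1 : (0 : ℝ) < (m : ℝ) + 1 := by positivity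
  set F : ι → ℝ := fun b => ∑ v ∈ G b, Λ b v ^ ((κ b : ℝ) / ((κ b : ℝ) + 1)) with hF
  have hF0 : ∀ b, 0 ≤ F b := fun b => sum_nonneg fun v hv => Real.rpow_nonneg (hΛ0 b v hv) _
  -- The factors for Hölder's inequality: one for each block, with weight `κ b / (m + 1)`,
  -- and one for the product of all blocks, with weight `1 / (m + 1)`.
  let w : Option ι → ℝ := fun o => o.elim (1 / ((m : ℝ) + 1)) fun b => (κ b : ℝ) / ((m : ℝ) + 1)
  let y : Option ι → (ι → V) → ℝ := fun o x =>
    o.elim (∏ b, Λ b (x b) ^ ((κ b : ℝ) / ((κ b : ℝ) + 1)))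
      fun b => a x ^ 2 * Λ b (x b) ^ (-(1 / ((κ b : ℝ) + 1)))
  have hmem : ∀ x ∈ Fintype.piFinset G, ∀ b, x b ∈ G b := fun x hx => Fintype.mem_piFinset.1 hx
  have hold := sum_prod_rpow_le (univ : Finset (Option ι)) (Fintype.piFinset G) w y
    (by
      rintro (_ | b) -
      · simp only [w, Option.elim]; positivity
      · simp only [w, Option.elim]; exact div_pos (hκ0 b) hm1)
    (by
      rw [Fintype.sum_option]
      simp only [w, Option.elim]
      rw [← sum_div, hmR]; field_simp; ring)
    (by
      rintro (_ | b) - x hx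
      · exact prod_nonneg fun b _ => Real.rpow_nonneg (hΛ0 b _ (hmem x hx b)) _
      · exact mul_nonneg (sq_nonneg _) (Real.rpow_nonneg (hΛ0 b _ (hmem x hx b)) _))
  simp only [Fintype.prod_option, w, y, Option.elim] at hold
  have hleft : ∀ x ∈ Fintype.piFinset G, a x ^ (2 * (m : ℝ) / ((m : ℝ) + 1)) ≤
      (∏ b, Λ b (x b) ^ ((κ b : ℝ) / ((κ b : ℝ) + 1))) ^ (1 / ((m : ℝ) + 1)) *
        ∏ b, (a x ^ 2 * Λ b (x b) ^ (-(1 / ((κ b : ℝ) + 1)))) ^ ((κ b : ℝ) / ((m : ℝ) + 1)) := by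
    intro x hx
    have hL : ∀ b, a x ^ 2 ≤ Λ b (x b) := by
      intro b
      have hxb : x ∈ {x' ∈ Fintype.piFinset G | x' b = x b} := mem_filter.2 ⟨hx, rfl⟩
      have h := single_le_sum (f := fun x => a x ^ 2) (fun x _ => sq_nonneg (a x)) hxb
      exact h.trans (hΛ b _ (hmem x hx b))
    rcases (ha x).eq_or_lt with h | h
    · rcases Nat.eq_zero_or_pos m with h0 | h0
      · have : IsEmpty ι := ⟨fun b => by
          have := single_le_sum (f := κ) (fun b _ => Nat.zero_le _) (mem_univ b)
          have := hκ b
          omega⟩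
        simp [h0]
      · rw [← h, Real.zero_rpow (by positivity)]
        refine mul_nonneg (Real.rpow_nonneg (prod_nonneg fun b _ =>
          Real.rpow_nonneg (hΛ0 b _ (hmem x hx b)) _) _) (prod_nonneg fun b _ =>
          Real.rpow_nonneg (mul_nonneg (sq_nonneg _)
            (Real.rpow_nonneg (hΛ0 b _ (hmem x hx b)) _)) _)
    · have hLp : ∀ b, 0 < Λ b (x b) := fun b => (pow_pos h 2).trans_le (hL b)
      refine le_of_eq ?_
      rw [← Real.finsetProd_rpow _ _ (fun b _ => Real.rpow_nonneg (hLp b).le _),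
        ← prod_mul_distrib]
      have : ∀ b ∈ (univ : Finset ι), (Λ b (x b) ^ ((κ b : ℝ) / ((κ b : ℝ) + 1))) ^ (1 / ((m : ℝ) + 1)) *
          (a x ^ 2 * Λ b (x b) ^ (-(1 / ((κ b : ℝ) + 1)))) ^ ((κ b : ℝ) / ((m : ℝ) + 1)) =
          a x ^ (2 * (κ b : ℝ) / ((m : ℝ) + 1)) := by
        intro b _
        rw [Real.mul_rpow (by positivity) (Real.rpow_nonneg (hLp b).le _),
          ← Real.rpow_mul (hLp b).le, ← Real.rpow_mul (hLp b).le, mul_left_comm,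
          ← Real.rpow_add (hLp b), ← Real.rpow_natCast, ← Real.rpow_mul h.le]
        have h1 : (κ b : ℝ) / ((κ b : ℝ) + 1) * (1 / ((m : ℝ) + 1)) +
            -(1 / ((κ b : ℝ) + 1)) * ((κ b : ℝ) / ((m : ℝ) + 1)) = 0 := by
          field_simp; ring
        rw [h1, Real.rpow_zero, mul_one]
        congr 1; push_cast; ring
      rw [prod_congr rfl this, ← Real.rpow_sum_of_pos h, ← sum_div, ← mul_sum, hmR]
  have hright : ∀ b, ∑ x ∈ Fintype.piFinset G, a x ^ 2 * Λ b (x b) ^ (-(1 / ((κ b : ℝ) + 1)))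
      ≤ F b := by
    intro b
    rw [← sum_fiberwise_of_maps_to (g := fun x : ι → V => x b) (t := G b)
      (fun x hx => hmem x hx b)]
    refine sum_le_sum fun v hv => ?_
    have : ∑ x ∈ Fintype.piFinset G with x b = v, a x ^ 2 * Λ b (x b) ^ (-(1 / ((κ b : ℝ) + 1))) =
        (∑ x ∈ Fintype.piFinset G with x b = v, a x ^ 2) * Λ b v ^ (-(1 / ((κ b : ℝ) + 1))) := by
      rw [sum_mul]
      exact sum_congr rfl fun x hx => by rw [(mem_filter.1 hx).2]
    rw [this]
    refine (mul_le_mul_of_nonneg_right (hΛ b v hv) (Real.rpow_nonneg (hΛ0 b v hv) _)).trans ?_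
    rcases (hΛ0 b v hv).eq_or_lt with h | h
    · rw [← h, zero_mul]; exact Real.rpow_nonneg le_rfl _
    · refine le_of_eq ?_
      nth_rewrite 1 [← Real.rpow_one (Λ b v)]
      rw [← Real.rpow_add h]
      congr 1
      have := hκ0 b
      field_simp; ring
  refine (sum_le_sum hleft).trans (hold.trans ?_)
  rw [show ∑ x ∈ Fintype.piFinset G, ∏ b, Λ b (x b) ^ ((κ b : ℝ) / ((κ b : ℝ) + 1)) = ∏ b, F b from
    (prod_univ_sum G fun b v => Λ b v ^ ((κ b : ℝ) / ((κ b : ℝ) + 1))).symm,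
    ← Real.finsetProd_rpow _ _ (fun b _ => hF0 b), ← prod_mul_distrib]
  refine prod_le_prod (fun b _ => mul_nonneg (Real.rpow_nonneg (hF0 b) _) (Real.rpow_nonneg
    (sum_nonneg fun x hx => mul_nonneg (sq_nonneg _)
      (Real.rpow_nonneg (hΛ0 b _ (hmem x hx b)) _)) _)) fun b _ => ?_
  have e1 : (((κ b : ℝ) + 1) / ((m : ℝ) + 1)) =
      1 / ((m : ℝ) + 1) + (κ b : ℝ) / ((m : ℝ) + 1) := by ring
  rw [e1, Real.rpow_add_of_nonneg (hF0 b) (by positivity) (by positivity)]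
  refine mul_le_mul_of_nonneg_left (Real.rpow_le_rpow (sum_nonneg fun x hx =>
    mul_nonneg (sq_nonneg _) (Real.rpow_nonneg (hΛ0 b _ (hmem x hx b)) _)) (hright b)
    (by positivity)) (Real.rpow_nonneg (hF0 b) _)

/-! ### Averages over roots of unity -/

/-- The multi-indices in `n` variables of degree `d`. -/
noncomputable abbrev multiIdx (n d : ℕ) : Finset (Fin n →₀ ℕ) :=
  finsuppAntidiag (univ : Finset (Fin n)) d

theorem mem_multiIdx {n d : ℕ} {α : Fin n →₀ ℕ} : α ∈ multiIdx n d ↔ ∑ i, α i = d := by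
  simp

theorem apply_le_of_mem_multiIdx {n d : ℕ} {α : Fin n →₀ ℕ} (h : α ∈ multiIdx n d) (i : Fin n) :
    α i ≤ d := by
  rw [← mem_multiIdx.1 h]
  exact single_le_sum (f := fun i => α i) (fun _ _ => Nat.zero_le _) (mem_univ i)

theorem add_mem_multiIdx {n d e : ℕ} {α β : Fin n →₀ ℕ} (hα : α ∈ multiIdx n d)
    (hβ : β ∈ multiIdx n e) : α + β ∈ multiIdx n (d + e) := by
  rw [mem_multiIdx] at *
  simp [sum_add_distrib, hα, hβ]

/-- The monomial function `z ^ α`. -/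
noncomputable def mon {n : ℕ} (z : Fin n → ℂ) (α : Fin n →₀ ℕ) : ℂ := ∏ i, z i ^ α i

theorem mon_add {n : ℕ} (z : Fin n → ℂ) (α β : Fin n →₀ ℕ) :
    mon z (α + β) = mon z α * mon z β := by
  simp [mon, pow_add, prod_mul_distrib]

theorem sum_rootOfUnity_pow_mul_conj {N : ℕ} {ζ : ℂ} (hζ : IsPrimitiveRoot ζ N) (h1 : ‖ζ‖ = 1)
    {a b : ℕ} (ha : a < N) (hb : b < N) :
    ∑ j : Fin N, (ζ ^ (j : ℕ)) ^ a * (starRingEnd ℂ) ((ζ ^ (j : ℕ)) ^ b) =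
      if a = b then (N : ℂ) else 0 := by
  have hconj : ∀ k : ℕ, ζ ^ k * (starRingEnd ℂ) (ζ ^ k) = 1 := fun k => by
    rw [Complex.mul_conj, Complex.normSq_eq_norm_sq]; simp [h1]
  have e : ∀ j : Fin N, (ζ ^ (j : ℕ)) ^ a * (starRingEnd ℂ) ((ζ ^ (j : ℕ)) ^ b) =
      (ζ ^ a * (starRingEnd ℂ) (ζ ^ b)) ^ (j : ℕ) := fun j => by
    simp only [map_pow, mul_pow, ← pow_mul, mul_comm]
  simp_rw [e]
  rw [Fin.sum_univ_eq_sum_range fun j => (ζ ^ a * (starRingEnd ℂ) (ζ ^ b)) ^ j]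
  split_ifs with hab
  · subst hab
    rw [hconj a]
    simp
  · have hne : ζ ^ a * (starRingEnd ℂ) (ζ ^ b) ≠ 1 := by
      intro h
      apply hab (hζ.pow_inj ha hb _)
      calc ζ ^ a = ζ ^ a * (ζ ^ b * (starRingEnd ℂ) (ζ ^ b)) := by rw [hconj, mul_one]
        _ = (ζ ^ a * (starRingEnd ℂ) (ζ ^ b)) * ζ ^ b := by ring
        _ = ζ ^ b := by rw [h, one_mul]
    rw [geom_sum_eq hne]
    have : (ζ ^ a * (starRingEnd ℂ) (ζ ^ b)) ^ N = 1 := by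
      rw [mul_pow, ← map_pow, ← pow_mul, ← pow_mul, mul_comm a, mul_comm b, pow_mul, pow_mul,
        hζ.pow_eq_one]
      simp
    rw [this, sub_self, zero_div]

/-- The point of the torus with the coordinates `ζ ^ x i`. -/
noncomputable def torusPt {n : ℕ} (ζ : ℂ) {N : ℕ} (x : Fin n → Fin N) : Fin n → ℂ :=
  fun i => ζ ^ (x i : ℕ)

/-- Parseval's identity on the grid of `N`-th roots of unity, valid as soon as all exponents
are less than `N`. -/
theorem sum_norm_sq_eq {n N : ℕ} {ζ : ℂ} (hζ : IsPrimitiveRoot ζ N) (h1 : ‖ζ‖ = 1)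
    (S : Finset (Fin n →₀ ℕ)) (hS : ∀ α ∈ S, ∀ i, α i < N) (c : (Fin n →₀ ℕ) → ℂ) :
    ∑ x : Fin n → Fin N, ‖∑ α ∈ S, c α * mon (torusPt ζ x) α‖ ^ 2 =
      (N : ℝ) ^ n * ∑ α ∈ S, ‖c α‖ ^ 2 := by
  have orth : ∀ α ∈ S, ∀ β ∈ S, ∑ x : Fin n → Fin N,
      mon (torusPt ζ x) α * (starRingEnd ℂ) (mon (torusPt ζ x) β) =
        if α = β then (N : ℂ) ^ n else 0 := by
    intro α hα β hβ
    have : ∀ x : Fin n → Fin N, mon (torusPt ζ x) α * (starRingEnd ℂ) (mon (torusPt ζ x) β) =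
        ∏ i, (ζ ^ (x i : ℕ)) ^ α i * (starRingEnd ℂ) ((ζ ^ (x i : ℕ)) ^ β i) := fun x => by
      simp only [mon, torusPt, map_prod, prod_mul_distrib]
    simp_rw [this]
    rw [← Fintype.prod_sum (fun i (j : Fin N) =>
      (ζ ^ (j : ℕ)) ^ α i * (starRingEnd ℂ) ((ζ ^ (j : ℕ)) ^ β i))]
    simp_rw [fun i => sum_rootOfUnity_pow_mul_conj hζ h1 (hS α hα i) (hS β hβ i)]
    split_ifs with h
    · subst h; simp
    · obtain ⟨i, hi⟩ := DFunLike.ne_iff.1 h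
      exact prod_eq_zero (mem_univ i) (if_neg hi)
  have hcast : ((∑ x : Fin n → Fin N, ‖∑ α ∈ S, c α * mon (torusPt ζ x) α‖ ^ 2 : ℝ) : ℂ) =
      ((N : ℝ) ^ n * ∑ α ∈ S, ‖c α‖ ^ 2 : ℝ) := by
    push_cast
    simp_rw [← Complex.mul_conj', map_sum, map_mul, sum_mul_sum]
    rw [sum_comm, mul_sum]
    refine sum_congr rfl fun α hα => ?_
    rw [sum_comm]
    have : ∀ β ∈ S, ∑ x : Fin n → Fin N, c α * mon (torusPt ζ x) α *
        ((starRingEnd ℂ) (c β) * (starRingEnd ℂ) (mon (torusPt ζ x) β)) =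
        if α = β then c α * (starRingEnd ℂ) (c β) * (N : ℂ) ^ n else 0 := by
      intro β hβ
      rw [← mul_ite_zero, ← orth α hα β hβ, mul_sum]
      exact sum_congr rfl fun x _ => by ring
    rw [sum_congr rfl this, sum_ite_eq, if_pos hα]
    ring
  exact_mod_cast hcast

/-! ### Comparison of moments of homogeneous polynomials -/

/-- A multi-index of degree `d` has at most `∏ i, (γ i + 1) ≤ 2 ^ d` decompositions into two
summands. -/
theorem card_filter_add_eq_le {n d : ℕ} {γ : Fin n →₀ ℕ} (hγ : γ ∈ multiIdx n d)
    (S : Finset ((Fin n →₀ ℕ) × (Fin n →₀ ℕ))) : #{p ∈ S | p.1 + p.2 = γ} ≤ 2 ^ d := by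
  classical
  have h1 : #{p ∈ S | p.1 + p.2 = γ} ≤ #(Iic γ) := by
    refine card_le_card_of_injOn Prod.fst ?_ ?_
    · intro p hp
      have := (mem_filter.1 hp).2
      simp only [coe_Iic, Set.mem_Iic, ← this, le_add_iff_nonneg_right, zero_le]
    · intro p hp q hq h
      have hp := (mem_filter.1 hp).2
      have hq := (mem_filter.1 hq).2
      refine Prod.ext h (add_left_cancel (a := p.1) ?_)
      rw [hp, h, hq]
  refine h1.trans ?_
  rw [Finsupp.card_Iic]
  calc ∏ i ∈ γ.support, #(Iic (γ i)) ≤ ∏ i ∈ γ.support, 2 ^ γ i := by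
        refine prod_le_prod (fun _ _ => Nat.zero_le _) fun i _ => ?_
        rw [Nat.card_Iic]; exact Nat.lt_two_pow_self
    _ = 2 ^ ∑ i ∈ γ.support, γ i := prod_pow_eq_pow_sum _ _ _
    _ = 2 ^ d := by
        rw [← mem_multiIdx.1 hγ, sum_subset (subset_univ _)]
        intro i _ hi
        simpa using hi

/-- A homogeneous polynomial `Q` of degree `d` satisfies `‖Q‖₄ ≤ 2^{d/2} ‖Q‖₂`: apply Parseval's
identity to `Q²` and the Cauchy-Schwarz inequality to each of its coefficients. -/
theorem sum_norm_pow_four_le {n N d : ℕ} {ζ : ℂ} (hζ : IsPrimitiveRoot ζ N) (h1 : ‖ζ‖ = 1)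
    (hN : 2 * d < N) (c : (Fin n →₀ ℕ) → ℂ) :
    ∑ x : Fin n → Fin N, ‖∑ α ∈ multiIdx n d, c α * mon (torusPt ζ x) α‖ ^ 4 ≤
      (N : ℝ) ^ n * (4 ^ d * (∑ α ∈ multiIdx n d, ‖c α‖ ^ 2) ^ 2) := by
  classical
  set S := multiIdx n d with hSdef
  let e : (Fin n →₀ ℕ) → ℂ := fun γ => ∑ p ∈ S ×ˢ S with p.1 + p.2 = γ, c p.1 * c p.2
  have hmaps : ∀ p ∈ S ×ˢ S, p.1 + p.2 ∈ multiIdx n (2 * d) := by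
    intro p hp
    rw [two_mul]
    exact add_mem_multiIdx (mem_product.1 hp).1 (mem_product.1 hp).2
  have hsq : ∀ z : Fin n → ℂ, (∑ α ∈ S, c α * mon z α) ^ 2 =
      ∑ γ ∈ multiIdx n (2 * d), e γ * mon z γ := by
    intro z
    rw [sq, sum_mul_sum, ← sum_product', ← sum_fiberwise_of_maps_to hmaps]
    refine sum_congr rfl fun γ _ => ?_
    rw [sum_mul]
    refine sum_congr rfl fun p hp => ?_
    rw [← (mem_filter.1 hp).2, mon_add]
    ring
  have e4 : ∀ x : Fin n → Fin N, ‖∑ α ∈ S, c α * mon (torusPt ζ x) α‖ ^ 4 =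
      ‖∑ γ ∈ multiIdx n (2 * d), e γ * mon (torusPt ζ x) γ‖ ^ 2 := fun x => by
    rw [← hsq, norm_pow, ← pow_mul]
  simp_rw [e4]
  rw [sum_norm_sq_eq hζ h1 _ fun α hα i => (apply_le_of_mem_multiIdx hα i).trans_lt hN]
  refine mul_le_mul_of_nonneg_left ?_ (by positivity)
  have he : ∀ γ ∈ multiIdx n (2 * d), ‖e γ‖ ^ 2 ≤
      4 ^ d * ∑ p ∈ S ×ˢ S with p.1 + p.2 = γ, ‖c p.1‖ ^ 2 * ‖c p.2‖ ^ 2 := by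
    intro γ hγ
    calc ‖e γ‖ ^ 2 ≤ (∑ p ∈ S ×ˢ S with p.1 + p.2 = γ, ‖c p.1 * c p.2‖) ^ 2 :=
          pow_le_pow_left₀ (norm_nonneg _) (norm_sum_le _ _) 2
      _ ≤ #{p ∈ S ×ˢ S | p.1 + p.2 = γ} *
          ∑ p ∈ S ×ˢ S with p.1 + p.2 = γ, ‖c p.1 * c p.2‖ ^ 2 := sq_sum_le_card_mul_sum_sq
      _ ≤ _ := by
          simp_rw [norm_mul, mul_pow]
          refine mul_le_mul_of_nonneg_right ?_ (sum_nonneg fun _ _ => by positivity)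
          have := card_filter_add_eq_le hγ (S ×ˢ S)
          rw [pow_mul] at this
          exact_mod_cast this
  refine (sum_le_sum he).trans (le_of_eq ?_)
  rw [← mul_sum, sum_fiberwise_of_maps_to hmaps fun p => ‖c p.1‖ ^ 2 * ‖c p.2‖ ^ 2,
    sum_product, sq, sum_mul_sum]

/-- Solves for the second moment `A` in the Hölder inequality of `sum_norm_sq_rpow_le`, where it
appears on both sides. -/
theorem mul_rpow_le_of_le_rpow_mul {M A T B k : ℝ} (hM : 0 < M) (hA : 0 < A) (hT : 0 ≤ T)
    (hB : 0 ≤ B) (hk : 0 < k)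
    (h : M * A ≤ T ^ ((k + 1) / (k + 2)) * (M * (B * A ^ 2)) ^ (1 / (k + 2))) :
    M * A ^ (k / (k + 1)) ≤ B ^ (1 / (k + 1)) * T := by
  have hMB : 0 ≤ M * (B * A ^ 2) := by positivity
  have hpw := Real.rpow_le_rpow (by positivity) h (show 0 ≤ (k + 2) / (k + 1) by positivity)
  have q1 : ((k + 1) / (k + 2)) * ((k + 2) / (k + 1)) = 1 := by field_simp
  have q2 : (1 / (k + 2)) * ((k + 2) / (k + 1)) = 1 / (k + 1) := by field_simp
  rw [Real.mul_rpow (Real.rpow_nonneg hT _) (Real.rpow_nonneg hMB _), ← Real.rpow_mul hT,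
    ← Real.rpow_mul hMB, q1, q2, Real.rpow_one, Real.mul_rpow hM.le hA.le,
    Real.mul_rpow hM.le (by positivity), Real.mul_rpow hB (by positivity)] at hpw
  have e1 : M ^ ((k + 2) / (k + 1)) = M * M ^ (1 / (k + 1)) := by
    rw [show (k + 2) / (k + 1) = 1 + 1 / (k + 1) by field_simp; ring, Real.rpow_add hM,
      Real.rpow_one]
  have e2 : A ^ ((k + 2) / (k + 1)) = A ^ (k / (k + 1)) * (A ^ 2) ^ (1 / (k + 1)) := by
    rw [← Real.rpow_natCast A 2, ← Real.rpow_mul hA.le, ← Real.rpow_add hA]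
    congr 1
    push_cast
    field_simp
  rw [e1, e2] at hpw
  have hu : 0 < M ^ (1 / (k + 1)) := Real.rpow_pos_of_pos hM _
  have hv : 0 < (A ^ 2) ^ (1 / (k + 1)) := Real.rpow_pos_of_pos (by positivity) _
  refine le_of_mul_le_mul_right ?_ (mul_pos hu hv)
  linarith [hpw]

/-- A homogeneous polynomial `Q` of degree `d` satisfies `‖Q‖₂ ≤ 2^{d/k} ‖Q‖_p` with
`p = 2k/(k+1)`, raised here to the power `p`. The base `2^{1/k}` tends to one as `p` tends to `2`,
because interpolation of `L²` between `L^p` and `L⁴` puts almost all of the weight on `L^p`. -/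
theorem sum_norm_sq_rpow_le {n N d : ℕ} {ζ : ℂ} (hζ : IsPrimitiveRoot ζ N) (h1 : ‖ζ‖ = 1)
    (hN : 2 * d < N) (c : (Fin n →₀ ℕ) → ℂ) {k : ℕ} (hk : 1 ≤ k) :
    (N : ℝ) ^ n * (∑ α ∈ multiIdx n d, ‖c α‖ ^ 2) ^ ((k : ℝ) / ((k : ℝ) + 1)) ≤
      4 ^ ((d : ℝ) / ((k : ℝ) + 1)) * ∑ x : Fin n → Fin N,
        ‖∑ α ∈ multiIdx n d, c α * mon (torusPt ζ x) α‖ ^ (2 * (k : ℝ) / ((k : ℝ) + 1)) := by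
  set A := ∑ α ∈ multiIdx n d, ‖c α‖ ^ 2 with hA
  set h : (Fin n → Fin N) → ℝ := fun x => ‖∑ α ∈ multiIdx n d, c α * mon (torusPt ζ x) α‖ with hh
  set p : ℝ := 2 * (k : ℝ) / ((k : ℝ) + 1) with hp
  set T : ℝ := ∑ x, h x ^ p with hT
  have hk0 : (0 : ℝ) < k := by exact_mod_cast hk
  have hN0 : (0 : ℝ) < (N : ℝ) ^ n := by
    have : 0 < N := by omega
    positivity
  have hh0 : ∀ x, 0 ≤ h x := fun x => norm_nonneg _
  have hT0 : 0 ≤ T := sum_nonneg fun x _ => Real.rpow_nonneg (hh0 x) _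
  have hA0 : 0 ≤ A := sum_nonneg fun x _ => sq_nonneg _
  have h2 : ∑ x, h x ^ 2 = (N : ℝ) ^ n * A :=
    sum_norm_sq_eq hζ h1 _ (fun α hα i => (apply_le_of_mem_multiIdx hα i).trans_lt (by omega)) c
  have h4 : ∑ x, h x ^ 4 ≤ (N : ℝ) ^ n * (4 ^ d * A ^ 2) := sum_norm_pow_four_le hζ h1 hN c
  rcases hA0.eq_or_lt with hz | hApos
  · rw [← hz, Real.zero_rpow (by positivity), mul_zero]
    positivity
  -- Hölder's inequality between the exponents `p` and `4`.
  have hold : ∑ x, h x ^ 2 ≤ T ^ (((k : ℝ) + 1) / ((k : ℝ) + 2)) *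
      (∑ x, h x ^ 4) ^ (1 / ((k : ℝ) + 2)) := by
    have := sum_prod_rpow_le (univ : Finset (Fin 2)) (univ : Finset (Fin n → Fin N))
      ![((k : ℝ) + 1) / ((k : ℝ) + 2), 1 / ((k : ℝ) + 2)] ![fun x => h x ^ p, fun x => h x ^ 4]
      (by simp only [mem_univ, forall_const, Fin.forall_fin_two]; constructor <;>
        simp <;> positivity)
      (by simp; field_simp; ring)
      (by
        simp only [mem_univ, forall_const, Fin.forall_fin_two]
        exact ⟨fun x => Real.rpow_nonneg (hh0 x) _, fun x => pow_nonneg (hh0 x) 4⟩)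
    simp only [Fin.prod_univ_two, Matrix.cons_val_zero, Matrix.cons_val_one] at this
    refine le_trans (le_of_eq (sum_congr rfl fun x _ => ?_)) this
    rw [← Real.rpow_natCast, ← Real.rpow_natCast, ← Real.rpow_mul (hh0 x), ← Real.rpow_mul (hh0 x),
      ← Real.rpow_add_of_nonneg (hh0 x) (by positivity) (by positivity)]
    congr 1
    rw [hp]; push_cast; field_simp; ring
  rw [h2] at hold
  have hold2 : (N : ℝ) ^ n * A ≤ T ^ (((k : ℝ) + 1) / ((k : ℝ) + 2)) *
      ((N : ℝ) ^ n * (4 ^ d * A ^ 2)) ^ (1 / ((k : ℝ) + 2)) :=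
    hold.trans (mul_le_mul_of_nonneg_left (Real.rpow_le_rpow
      (sum_nonneg fun x _ => pow_nonneg (hh0 x) 4) h4 (by positivity)) (Real.rpow_nonneg hT0 _))
  have := mul_rpow_le_of_le_rpow_mul hN0 hApos hT0 (show (0 : ℝ) ≤ 4 ^ d by positivity) hk0 hold2
  rwa [← Real.rpow_natCast 4 d, ← Real.rpow_mul (by norm_num : (0:ℝ) ≤ 4), mul_one_div] at this

/-! ### Homogeneous polynomials on the polydisk -/

theorem eval_eq_sum_multiIdx {n m : ℕ} {P : MvPolynomial (Fin n) ℂ} (hP : P.IsHomogeneous m)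
    (z : Fin n → ℂ) :
    MvPolynomial.eval z P = ∑ α ∈ multiIdx n m, MvPolynomial.coeff α P * mon z α := by
  rw [MvPolynomial.eval_eq']
  refine sum_subset (fun α hα => ?_) fun α _ hα => ?_
  · rw [mem_multiIdx, ← Finsupp.degree_eq_sum]
    by_contra h
    exact MvPolynomial.mem_support_iff.1 hα (hP.coeff_eq_zero h)
  · rw [MvPolynomial.notMem_support_iff.1 hα, zero_mul]

theorem isHomogeneous_sum_monomial {n k : ℕ} (c : (Fin n →₀ ℕ) → ℂ) :
    (∑ γ ∈ multiIdx n k, MvPolynomial.monomial γ (c γ)).IsHomogeneous k :=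
  MvPolynomial.IsHomogeneous.sum _ _ _ fun γ hγ =>
    MvPolynomial.isHomogeneous_monomial _ (by rw [Finsupp.degree_eq_sum, mem_multiIdx.1 hγ])

theorem coeff_sum_monomial {n k : ℕ} (c : (Fin n →₀ ℕ) → ℂ) {γ : Fin n →₀ ℕ}
    (hγ : γ ∈ multiIdx n k) :
    MvPolynomial.coeff γ (∑ γ ∈ multiIdx n k, MvPolynomial.monomial γ (c γ)) = c γ := by
  classical
  rw [MvPolynomial.coeff_sum]
  simp only [MvPolynomial.coeff_monomial]
  rw [sum_ite_eq', if_pos hγ]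

theorem polydiskNorm_nonneg {n : ℕ} (P : MvPolynomial (Fin n) ℂ) : 0 ≤ polydiskNorm P := by
  refine Real.sSup_nonneg ?_
  rintro _ ⟨z, -, rfl⟩
  exact norm_nonneg _

theorem norm_eval_le_of_lt_one {n : ℕ} (P : MvPolynomial (Fin n) ℂ) {z : Fin n → ℂ}
    (hz : ∀ i, ‖z i‖ < 1) : ‖MvPolynomial.eval z P‖ ≤ polydiskNorm P :=
  le_csSup (bddAbove_polydisk P) ⟨z, hz, rfl⟩

theorem polydiskNorm_le {n : ℕ} {P : MvPolynomial (Fin n) ℂ} {M : ℝ}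
    (h : ∀ z : Fin n → ℂ, (∀ i, ‖z i‖ < 1) → ‖MvPolynomial.eval z P‖ ≤ M) :
    polydiskNorm P ≤ M := by
  refine csSup_le ⟨_, 0, by simp, rfl⟩ ?_
  rintro _ ⟨z, hz, rfl⟩
  exact h z hz

theorem mon_smul {n m : ℕ} (s : ℂ) (z : Fin n → ℂ) {α : Fin n →₀ ℕ} (hα : α ∈ multiIdx n m) :
    mon (s • z) α = s ^ m * mon z α := by
  simp only [mon, Pi.smul_apply, smul_eq_mul, mul_pow, prod_mul_distrib]
  rw [prod_pow_eq_pow_sum, mem_multiIdx.1 hα]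

theorem eval_smul_of_isHomogeneous {n m : ℕ} {P : MvPolynomial (Fin n) ℂ}
    (hP : P.IsHomogeneous m) (s : ℂ) (z : Fin n → ℂ) :
    MvPolynomial.eval (s • z) P = s ^ m * MvPolynomial.eval z P := by
  rw [eval_eq_sum_multiIdx hP, eval_eq_sum_multiIdx hP, mul_sum]
  exact sum_congr rfl fun α hα => by rw [mon_smul s z hα]; ring

/-- By homogeneity and continuity, the norm over the open polydisk also controls the values on
closed polydisks of every radius. -/
theorem norm_eval_le {n m : ℕ} {P : MvPolynomial (Fin n) ℂ} (hP : P.IsHomogeneous m) {R : ℝ}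
    (hR : 0 ≤ R) {z : Fin n → ℂ} (hz : ∀ i, ‖z i‖ ≤ R) :
    ‖MvPolynomial.eval z P‖ ≤ R ^ m * polydiskNorm P := by
  have hlt : ∀ s, R < s → ‖MvPolynomial.eval z P‖ ≤ s ^ m * polydiskNorm P := by
    intro s hs
    have hs0 : 0 < s := hR.trans_lt hs
    have hsC : (s : ℂ) ≠ 0 := by exact_mod_cast hs0.ne'
    have h1 : z = (s : ℂ) • ((s : ℂ)⁻¹ • z) := by rw [smul_smul, mul_inv_cancel₀ hsC, one_smul]
    rw [h1, eval_smul_of_isHomogeneous hP, norm_mul, norm_pow, Complex.norm_real,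
      Real.norm_of_nonneg hs0.le]
    refine mul_le_mul_of_nonneg_left (norm_eval_le_of_lt_one P fun i => ?_) (by positivity)
    rw [Pi.smul_apply, smul_eq_mul, norm_mul, norm_inv, Complex.norm_real,
      Real.norm_of_nonneg hs0.le, inv_mul_lt_iff₀ hs0, mul_one]
    exact (hz i).trans_lt hs
  have hc : Filter.Tendsto (fun s : ℝ => s ^ m * polydiskNorm P) (nhdsWithin R (Set.Ioi R))
      (nhds (R ^ m * polydiskNorm P)) := by
    have : Continuous fun s : ℝ => s ^ m * polydiskNorm P := by fun_prop
    exact this.continuousWithinAt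
  exact ge_of_tendsto hc (Filter.eventually_of_mem self_mem_nhdsWithin hlt)

/-! ### Taylor coefficients -/

/-- Cauchy's estimate for the coefficients of a polynomial bounded on the unit circle. -/
theorem norm_coeff_le_of_norm_sum_le {m : ℕ} (A : ℕ → ℂ) {M : ℝ}
    (h : ∀ t : ℂ, ‖t‖ = 1 → ‖∑ k ∈ range (m + 1), t ^ k * A k‖ ≤ M) {k : ℕ} (hk : k ≤ m) :
    ‖A k‖ ≤ M := by
  set N := m + 1
  obtain ⟨ζ, hζ⟩ : ∃ ζ : ℂ, IsPrimitiveRoot ζ N := ⟨_, Complex.isPrimitiveRoot_exp N (by omega)⟩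
  have h1 : ‖ζ‖ = 1 := hζ.norm'_eq_one (by omega)
  have e : ∑ j : Fin N, (∑ l ∈ range N, (ζ ^ (j : ℕ)) ^ l * A l) *
      (starRingEnd ℂ) ((ζ ^ (j : ℕ)) ^ k) = N * A k := by
    simp_rw [sum_mul]
    rw [sum_comm]
    have : ∀ l ∈ range N, ∑ j : Fin N, (ζ ^ (j : ℕ)) ^ l * A l *
        (starRingEnd ℂ) ((ζ ^ (j : ℕ)) ^ k) = if l = k then (N : ℂ) * A l else 0 := by
      intro l hl
      rw [← ite_zero_mul, ← sum_rootOfUnity_pow_mul_conj hζ h1 (mem_range.1 hl) (by omega),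
        sum_mul]
      exact sum_congr rfl fun j _ => by ring
    rw [sum_congr rfl this, sum_ite_eq', if_pos (mem_range.2 (by omega))]
  have hb : ‖(N : ℂ) * A k‖ ≤ N * M := by
    rw [← e]
    refine (norm_sum_le _ _).trans ?_
    have : ∀ j ∈ (univ : Finset (Fin N)), ‖(∑ l ∈ range N, (ζ ^ (j : ℕ)) ^ l * A l) *
      (starRingEnd ℂ) ((ζ ^ (j : ℕ)) ^ k)‖ ≤ M := by
      intro j _
      rw [norm_mul, Complex.norm_conj]
      simpa [h1] using h (ζ ^ (j : ℕ)) (by simp [h1])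
    simpa using sum_le_sum this
  rw [norm_mul, Complex.norm_natCast] at hb
  exact le_of_mul_le_mul_left hb (by positivity)

/-- The binomial theorem for multi-indices. -/
theorem mon_add_left {n : ℕ} (z w : Fin n → ℂ) (α : Fin n →₀ ℕ) :
    mon (z + w) α = ∑ p ∈ antidiagonal α,
      (∏ i, ((α i).choose (p.2 i) : ℂ)) * (mon z p.1 * mon w p.2) := by
  have h : ∀ i, (z + w) i ^ α i = ∑ q ∈ antidiagonal (α i),
      ((α i).choose q.2 : ℂ) * (z i ^ q.1 * w i ^ q.2) := by
    intro i
    rw [Pi.add_apply, (Commute.all (z i) (w i)).add_pow']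
    refine sum_congr rfl fun q hq => ?_
    rw [nsmul_eq_mul, Nat.choose_symm_of_eq_add (HasAntidiagonal.mem_antidiagonal.1 hq).symm]
  rw [mon, prod_congr rfl fun i _ => h i, prod_univ_sum]
  refine sum_bij' (fun q _ => (Finsupp.equivFunOnFinite.symm fun i => (q i).1,
      Finsupp.equivFunOnFinite.symm fun i => (q i).2))
    (fun p _ => fun i => (p.1 i, p.2 i)) ?_ ?_ ?_ ?_ ?_
  · intro q hq
    rw [HasAntidiagonal.mem_antidiagonal]
    ext i
    exact HasAntidiagonal.mem_antidiagonal.1 (Fintype.mem_piFinset.1 hq i)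
  · intro p hp
    rw [Fintype.mem_piFinset]
    intro i
    rw [HasAntidiagonal.mem_antidiagonal, ← HasAntidiagonal.mem_antidiagonal.1 hp]
    rfl
  · intro q hq; rfl
  · intro p hp; ext <;> rfl
  · intro q hq
    simp [mon, prod_mul_distrib]

/-- The value at `z` of the Hasse derivative `∂ ^ γ P / γ!` of an `m`-homogeneous polynomial `P`,
for a multi-index `γ` of degree `k`. -/
noncomputable def hasse {n : ℕ} (m k : ℕ) (P : MvPolynomial (Fin n) ℂ) (γ : Fin n →₀ ℕ)
    (z : Fin n → ℂ) : ℂ :=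
  ∑ β ∈ multiIdx n (m - k),
    (∏ i, (((β + γ) i).choose (γ i) : ℂ)) * MvPolynomial.coeff (β + γ) P * mon z β

/-- The Taylor expansion of a homogeneous polynomial, by degrees in the increment. -/
theorem eval_add_smul {n m : ℕ} {P : MvPolynomial (Fin n) ℂ} (hP : P.IsHomogeneous m)
    (z w : Fin n → ℂ) (t : ℂ) :
    MvPolynomial.eval (z + t • w) P =
      ∑ k ∈ range (m + 1), t ^ k * ∑ γ ∈ multiIdx n k, hasse m k P γ z * mon w γ := by
  rw [eval_eq_sum_multiIdx hP]
  have h1 : ∀ k ∈ range (m + 1), t ^ k * ∑ γ ∈ multiIdx n k, hasse m k P γ z * mon w γ =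
      ∑ γ ∈ multiIdx n k, ∑ β ∈ multiIdx n (m - k), MvPolynomial.coeff (β + γ) P *
        ((∏ i, (((β + γ) i).choose (γ i) : ℂ)) * (mon z β * mon (t • w) γ)) := by
    intro k _
    rw [mul_sum]
    refine sum_congr rfl fun γ hγ => ?_
    rw [hasse, sum_mul, mul_sum]
    refine sum_congr rfl fun β _ => ?_
    rw [mon_smul t w hγ]
    ring
  rw [sum_congr rfl h1]
  simp_rw [mon_add_left, mul_sum]
  simp_rw [sum_sigma']
  refine sum_bij' (fun q _ => ⟨∑ i, q.2.2 i, q.2.2, q.2.1⟩)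
    (fun q _ => ⟨q.2.2 + q.2.1, (q.2.2, q.2.1)⟩) ?_ ?_ ?_ ?_ ?_
  · rintro ⟨α, β, γ⟩ h
    simp only [mem_sigma, mem_multiIdx, HasAntidiagonal.mem_antidiagonal, mem_range, true_and] at h ⊢
    obtain ⟨h1, rfl⟩ := h
    simp only [Finsupp.coe_add, Pi.add_apply, sum_add_distrib] at h1
    omega
  · rintro ⟨k, γ, β⟩ h
    simp only [mem_sigma, mem_multiIdx, HasAntidiagonal.mem_antidiagonal, mem_range] at h ⊢
    simp only [Finsupp.coe_add, Pi.add_apply, sum_add_distrib, and_true]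
    omega
  · rintro ⟨α, β, γ⟩ h
    simp only [mem_sigma, HasAntidiagonal.mem_antidiagonal] at h
    obtain ⟨_, rfl⟩ := h
    rfl
  · rintro ⟨k, γ, β⟩ h
    simp only [mem_sigma, mem_multiIdx, mem_range] at h
    obtain ⟨_, rfl, _⟩ := h
    rfl
  · rintro ⟨α, β, γ⟩ h
    simp only [mem_sigma, HasAntidiagonal.mem_antidiagonal] at h
    obtain ⟨_, rfl⟩ := h
    rfl

/-- The homogeneous part of degree `k` in the Taylor expansion of `P` at a point of the polydisk is
at most `e m^k ‖P‖` on the polydisk. Cauchy's estimate with increments of size `1/m` loses only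
`(1 + 1/m)^m ≤ e`. -/
theorem norm_sum_hasse_le {n m k : ℕ} (hm : 1 ≤ m) (hk : k ≤ m) {P : MvPolynomial (Fin n) ℂ}
    (hP : P.IsHomogeneous m) {z w : Fin n → ℂ} (hz : ∀ i, ‖z i‖ ≤ 1) (hw : ∀ i, ‖w i‖ ≤ 1) :
    ‖∑ γ ∈ multiIdx n k, hasse m k P γ z * mon w γ‖ ≤
      (m : ℝ) ^ k * (Real.exp 1 * polydiskNorm P) := by
  have hm0 : (0 : ℝ) < m := by exact_mod_cast hm
  have hmC : (m : ℂ) ≠ 0 := by exact_mod_cast hm0.ne'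
  have := norm_coeff_le_of_norm_sum_le (m := m) (M := Real.exp 1 * polydiskNorm P)
    (fun k => (m : ℂ)⁻¹ ^ k * ∑ γ ∈ multiIdx n k, hasse m k P γ z * mon w γ) (fun t ht => by
      have e := eval_add_smul hP z w (t * (m : ℂ)⁻¹)
      simp only [mul_pow, mul_assoc] at e
      rw [← e]
      refine (norm_eval_le hP (R := 1 + 1 / (m : ℝ)) (by positivity) fun i => ?_).trans ?_
      · refine (norm_add_le _ _).trans (add_le_add (hz i) ?_)
        rw [Pi.smul_apply, smul_eq_mul, norm_mul, norm_mul, ht, one_mul, norm_inv,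
          Complex.norm_natCast, one_div]
        exact mul_le_of_le_one_right (by positivity) (hw i)
      · refine mul_le_mul_of_nonneg_right ?_ (polydiskNorm_nonneg P)
        have h1 : 1 + 1 / (m : ℝ) ≤ Real.exp (1 / m) := by
          linarith [Real.add_one_le_exp (1 / (m : ℝ))]
        refine (pow_le_pow_left₀ (by positivity) h1 m).trans (le_of_eq ?_)
        rw [← Real.exp_nat_mul]
        congr 1
        field_simp) hk
  rw [norm_mul, norm_pow, norm_inv, Complex.norm_natCast, inv_pow,
    inv_mul_le_iff₀ (by positivity)] at this
  exact this

/-! ### The mixed norm of the coefficients for one block -/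

theorem coeffNorm_nonneg {n : ℕ} (m : ℕ) (P : MvPolynomial (Fin n) ℂ) : 0 ≤ coeffNorm m P :=
  Real.rpow_nonneg (sum_nonneg fun _ _ => Real.rpow_nonneg (norm_nonneg _) _) _

theorem coeffNorm_rpow {n m : ℕ} (hm : 1 ≤ m) (P : MvPolynomial (Fin n) ℂ) :
    coeffNorm m P ^ (2 * (m : ℝ) / ((m : ℝ) + 1)) =
      ∑ α ∈ multiIdx n m, ‖MvPolynomial.coeff α P‖ ^ (2 * (m : ℝ) / ((m : ℝ) + 1)) := by
  have hm0 : (0 : ℝ) < m := by exact_mod_cast hm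
  rw [coeffNorm, ← Real.rpow_mul (sum_nonneg fun _ _ => Real.rpow_nonneg (norm_nonneg _) _)]
  rw [show ((m : ℝ) + 1) / (2 * (m : ℝ)) * (2 * (m : ℝ) / ((m : ℝ) + 1)) = 1 by field_simp,
    Real.rpow_one]

/-- The polynomial `z ^ m` in one variable has both norms equal to one. -/
theorem polConstants_one_le {m : ℕ} (hm : 1 ≤ m) {D : ℝ} (hD : D ∈ polConstants m) : 1 ≤ D := by
  classical
  set P : MvPolynomial (Fin 1) ℂ := MvPolynomial.X 0 ^ m with hPdef
  have hP : P.IsHomogeneous m := MvPolynomial.isHomogeneous_X_pow 0 m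
  have h := hD 1 le_rfl P hP
  have h1 : polydiskNorm P ≤ 1 := polydiskNorm_le fun z hz => by
    rw [hPdef]
    simp only [map_pow, MvPolynomial.eval_X, norm_pow]
    exact pow_le_one₀ (norm_nonneg _) (hz 0).le
  have h2 : 1 ≤ coeffNorm m P := by
    refine Real.one_le_rpow ?_ (by positivity)
    have hmem : Finsupp.single 0 m ∈ multiIdx 1 m := by rw [mem_multiIdx]; simp
    refine le_trans (le_of_eq ?_) (single_le_sum
      (f := fun α => ‖MvPolynomial.coeff α P‖ ^ (2 * (m : ℝ) / ((m : ℝ) + 1)))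
      (fun _ _ => Real.rpow_nonneg (norm_nonneg _) _) hmem)
    simp [hPdef, MvPolynomial.coeff_X_pow]
  have h0 := polydiskNorm_nonneg P
  by_contra! hlt
  rcases le_total D 0 with hD0 | hD0
  · linarith [mul_nonpos_of_nonpos_of_nonneg hD0 h0]
  · linarith [mul_le_of_le_one_right hD0 h1]

/-- The inequality of degree `k` bounds a mixed norm of the coefficients of a polynomial of degree
`m ≥ k`. The inner `ℓ²` norm is at most the `L²` norm of the Hasse derivative of index `γ`, whose
binomial factors are at least one. It is replaced by the `L^{2k/(k+1)}` norm, at the cost of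
`2^{m/k}`, and the sum over `γ` is then estimated pointwise on the torus. -/
theorem sum_block_rpow_le {n m k : ℕ} (hn : 1 ≤ n) (hk1 : 1 ≤ k) (hk : k ≤ m)
    {P : MvPolynomial (Fin n) ℂ} (hP : P.IsHomogeneous m) {D : ℝ} (hD : D ∈ polConstants k) :
    ∑ γ ∈ multiIdx n k, (∑ β ∈ multiIdx n (m - k), ‖MvPolynomial.coeff (β + γ) P‖ ^ 2) ^
        ((k : ℝ) / ((k : ℝ) + 1)) ≤
      (2 ^ ((m : ℝ) / k) * D * Real.exp 1 * (m : ℝ) ^ k * polydiskNorm P) ^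
        (2 * (k : ℝ) / ((k : ℝ) + 1)) := by
  have hm1 : 1 ≤ m := hk1.trans hk
  have hk0 : (0 : ℝ) < k := by exact_mod_cast hk1
  set p : ℝ := 2 * (k : ℝ) / ((k : ℝ) + 1) with hp
  have hp0 : 0 ≤ p := by positivity
  have hD0 : 0 ≤ D := zero_le_one.trans (polConstants_one_le hk1 hD)
  -- The grid resolves degrees up to `2 (m - k)`, as fourth moments of Hasse derivatives require.
  set N := 2 * m + 1 with hNdef
  obtain ⟨ζ, hζ⟩ : ∃ ζ : ℂ, IsPrimitiveRoot ζ N := ⟨_, Complex.isPrimitiveRoot_exp N (by omega)⟩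
  have h1 : ‖ζ‖ = 1 := hζ.norm'_eq_one (by omega)
  have hN0 : (0 : ℝ) < (N : ℝ) ^ n := by positivity
  set U := D * ((m : ℝ) ^ k * (Real.exp 1 * polydiskNorm P)) with hU
  have hU0 : 0 ≤ U := by have := polydiskNorm_nonneg P; positivity
  -- At a fixed point `z` of the torus, the inequality of degree `k` applies to the homogeneous
  -- part of degree `k` of the Taylor expansion of `P` at `z`.
  have hz : ∀ z : Fin n → ℂ, (∀ i, ‖z i‖ ≤ 1) →
      ∑ γ ∈ multiIdx n k, ‖hasse m k P γ z‖ ^ p ≤ U ^ p := by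
    intro z hz
    set T : MvPolynomial (Fin n) ℂ :=
      ∑ γ ∈ multiIdx n k, MvPolynomial.monomial γ (hasse m k P γ z) with hT
    have hTh : T.IsHomogeneous k := isHomogeneous_sum_monomial _
    have hc : ∀ γ ∈ multiIdx n k, MvPolynomial.coeff γ T = hasse m k P γ z := fun γ hγ =>
      coeff_sum_monomial (fun γ => hasse m k P γ z) hγ
    have hTn : polydiskNorm T ≤ (m : ℝ) ^ k * (Real.exp 1 * polydiskNorm P) :=
      polydiskNorm_le fun w hw => by
        rw [eval_eq_sum_multiIdx hTh, sum_congr rfl fun γ hγ => by rw [hc γ hγ]]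
        exact norm_sum_hasse_le hm1 hk hP hz fun i => (hw i).le
    have := Real.rpow_le_rpow (coeffNorm_nonneg k T)
      ((hD n hn T hTh).trans (mul_le_mul_of_nonneg_left hTn hD0)) hp0
    rw [coeffNorm_rpow hk1] at this
    rwa [sum_congr rfl fun γ hγ => by rw [hc γ hγ]] at this
  have hγ : ∀ γ ∈ multiIdx n k, (N : ℝ) ^ n * (∑ β ∈ multiIdx n (m - k),
      ‖MvPolynomial.coeff (β + γ) P‖ ^ 2) ^ ((k : ℝ) / ((k : ℝ) + 1)) ≤
      4 ^ ((m : ℝ) / ((k : ℝ) + 1)) *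
        ∑ x : Fin n → Fin N, ‖hasse m k P γ (torusPt ζ x)‖ ^ p := by
    intro γ _
    have hyp := sum_norm_sq_rpow_le hζ h1 (show 2 * (m - k) < N by omega)
      (fun β => (∏ i, (((β + γ) i).choose (γ i) : ℂ)) * MvPolynomial.coeff (β + γ) P) hk1
    refine le_trans (mul_le_mul_of_nonneg_left (Real.rpow_le_rpow
      (sum_nonneg fun _ _ => sq_nonneg _) (sum_le_sum fun β _ => ?_) (by positivity)) hN0.le)
      (hyp.trans (mul_le_mul_of_nonneg_right ?_
        (sum_nonneg fun _ _ => Real.rpow_nonneg (norm_nonneg _) _)))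
    · refine pow_le_pow_left₀ (norm_nonneg _) ?_ 2
      rw [norm_mul]
      refine le_mul_of_one_le_left (norm_nonneg _) ?_
      rw [norm_prod]
      simp only [Complex.norm_natCast]
      have : 1 ≤ ∏ i, ((β + γ) i).choose (γ i) :=
        one_le_prod' fun i _ => Nat.choose_pos (by simp)
      exact_mod_cast this
    · refine Real.rpow_le_rpow_of_exponent_le (by norm_num) ?_
      gcongr
      omega
  have hsum := sum_le_sum hγ
  rw [← mul_sum, ← mul_sum, sum_comm] at hsum
  have hsum2 : ∑ x : Fin n → Fin N, ∑ γ ∈ multiIdx n k, ‖hasse m k P γ (torusPt ζ x)‖ ^ p ≤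
      (N : ℝ) ^ n * U ^ p := by
    refine (sum_le_sum fun x _ => hz (torusPt ζ x) fun i => by simp [torusPt, h1]).trans ?_
    simp
  have h4 : (4 : ℝ) ^ ((m : ℝ) / ((k : ℝ) + 1)) = (2 ^ ((m : ℝ) / k)) ^ p := by
    rw [show (4 : ℝ) = 2 ^ (2 : ℝ) by norm_num, ← Real.rpow_mul (by norm_num),
      ← Real.rpow_mul (by norm_num), hp]
    congr 1
    field_simp
  have e : (2 ^ ((m : ℝ) / k) * D * Real.exp 1 * (m : ℝ) ^ k * polydiskNorm P) ^ p =
      4 ^ ((m : ℝ) / ((k : ℝ) + 1)) * U ^ p := by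
    rw [h4, ← Real.mul_rpow (by positivity) hU0, hU]
    congr 1
    ring
  rw [e]
  refine le_of_mul_le_mul_left (hsum.trans ?_) hN0
  refine (mul_le_mul_of_nonneg_left hsum2 (by positivity)).trans (le_of_eq (by ring))

/-! ### Decomposition of multi-indices into blocks -/

theorem exists_le_degree_eq {n : ℕ} (α : Fin n →₀ ℕ) {d : ℕ} (hd : d ≤ ∑ i, α i) :
    ∃ β ≤ α, ∑ i, β i = d := by
  induction d with
  | zero => exact ⟨0, zero_le, by simp⟩
  | succ d ih =>
    obtain ⟨β, hβ, hs⟩ := ih (by omega)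
    have hlt : ∑ i, β i < ∑ i, α i := by omega
    obtain ⟨i, -, hi⟩ := exists_lt_of_sum_lt hlt
    refine ⟨β + Finsupp.single i 1, fun j => ?_, ?_⟩
    · have := hβ j
      rcases eq_or_ne i j with rfl | hij
      · simp; omega
      · simpa [Finsupp.single_eq_of_ne' hij] using this
    · simp [sum_add_distrib, hs, Finsupp.single_apply]

theorem exists_sum_eq_of_degree_eq {ι : Type*} [DecidableEq ι] {n : ℕ} (κ : ι → ℕ) (s : Finset ι)
    (α : Fin n →₀ ℕ) (hα : ∑ i, α i = ∑ b ∈ s, κ b) :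
    ∃ x : ι → Fin n →₀ ℕ, (∀ b ∈ s, x b ∈ multiIdx n (κ b)) ∧ ∑ b ∈ s, x b = α := by
  induction s using Finset.induction_on generalizing α with
  | empty =>
    refine ⟨0, by simp, ?_⟩
    ext i
    have := sum_eq_zero_iff.1 (hα.trans sum_empty) i (mem_univ i)
    simp [this]
  | insert c s hc ih =>
    rw [sum_insert hc] at hα
    obtain ⟨β, hβ, hd⟩ := exists_le_degree_eq α (d := κ c) (by omega)
    obtain ⟨δ, rfl⟩ := exists_add_of_le hβ
    obtain ⟨x, hx, hs⟩ := ih δ (by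
      simp only [Finsupp.coe_add, Pi.add_apply, sum_add_distrib] at hα
      omega)
    have hne : ∀ b ∈ s, Function.update x c β b = x b := fun b hb =>
      Function.update_of_ne (by rintro rfl; exact hc hb) _ _
    refine ⟨Function.update x c β, fun b hb => ?_, ?_⟩
    · rcases mem_insert.1 hb with rfl | hb
      · rw [Function.update_self, mem_multiIdx, hd]
      · rw [hne b hb]; exact hx b hb
    · rw [sum_insert hc, sum_congr rfl hne, hs, Function.update_self]

theorem sum_mem_multiIdx {ι : Type*} {n : ℕ} (s : Finset ι) {κ : ι → ℕ} {x : ι → Fin n →₀ ℕ}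
    (hx : ∀ b ∈ s, x b ∈ multiIdx n (κ b)) : ∑ b ∈ s, x b ∈ multiIdx n (∑ b ∈ s, κ b) := by
  rw [mem_multiIdx]
  simp only [Finsupp.coe_finsetSum, Finset.sum_apply]
  rw [sum_comm]
  exact sum_congr rfl fun b hb => mem_multiIdx.1 (hx b hb)

/-- The Blei-type inequality transferred to coefficients indexed by multi-indices. The coefficient
`c α` is spread evenly over all decompositions of `α` into blocks. In the mixed norm with the block
`b` fixed equal to `γ`, the decompositions of `β + γ` that occur are among all those of `β + γ`,
so that every `‖c (β + γ)‖²` is counted at most once. -/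
theorem sum_coeff_rpow_le_prod {ι : Type*} [Fintype ι] [DecidableEq ι] {n m : ℕ} (hm1 : 1 ≤ m)
    (κ : ι → ℕ) (hκ : ∀ b, 1 ≤ κ b) (hm : ∑ b, κ b = m) (c : (Fin n →₀ ℕ) → ℂ) :
    ∑ α ∈ multiIdx n m, ‖c α‖ ^ (2 * (m : ℝ) / ((m : ℝ) + 1)) ≤
      ∏ b, (∑ γ ∈ multiIdx n (κ b), (∑ β ∈ multiIdx n (m - κ b), ‖c (β + γ)‖ ^ 2) ^
        ((κ b : ℝ) / ((κ b : ℝ) + 1))) ^ (((κ b : ℝ) + 1) / ((m : ℝ) + 1)) := by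
  have hm0 : (0 : ℝ) < m := by exact_mod_cast hm1
  set Γ := Fintype.piFinset fun b => multiIdx n (κ b) with hΓ
  have hmaps : ∀ x ∈ Γ, ∑ b, x b ∈ multiIdx n m := fun x hx => by
    rw [← hm]
    exact sum_mem_multiIdx univ fun b _ => Fintype.mem_piFinset.1 hx b
  -- `r α` is the number of decompositions of `α` into blocks.
  let r : (Fin n →₀ ℕ) → ℕ := fun α => #{x ∈ Γ | ∑ b, x b = α}
  have hr : ∀ α ∈ multiIdx n m, 1 ≤ r α := by
    intro α hα
    obtain ⟨x, hx, hs⟩ := exists_sum_eq_of_degree_eq κ univ α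
      ((mem_multiIdx.1 hα).trans hm.symm)
    exact card_pos.2 ⟨x, mem_filter.2 ⟨Fintype.mem_piFinset.2 fun b => hx b (mem_univ b), hs⟩⟩
  let a : (ι → Fin n →₀ ℕ) → ℝ := fun x =>
    ‖c (∑ b, x b)‖ * ((r (∑ b, x b) : ℝ)⁻¹) ^ (((m : ℝ) + 1) / (2 * (m : ℝ)))
  have ha : ∀ x, 0 ≤ a x := fun x => by positivity
  have hsum : ∑ x ∈ Γ, a x ^ (2 * (m : ℝ) / ((m : ℝ) + 1)) =
      ∑ α ∈ multiIdx n m, ‖c α‖ ^ (2 * (m : ℝ) / ((m : ℝ) + 1)) := by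
    rw [← sum_fiberwise_of_maps_to hmaps]
    refine sum_congr rfl fun α hα => ?_
    have : ∀ x ∈ Γ.filter (fun x => ∑ b, x b = α), a x ^ (2 * (m : ℝ) / ((m : ℝ) + 1)) =
        ‖c α‖ ^ (2 * (m : ℝ) / ((m : ℝ) + 1)) * (r α : ℝ)⁻¹ := by
      intro x hx
      simp only [a, (mem_filter.1 hx).2]
      rw [Real.mul_rpow (by positivity) (by positivity), ← Real.rpow_mul (by positivity),
        show ((m : ℝ) + 1) / (2 * (m : ℝ)) * (2 * (m : ℝ) / ((m : ℝ) + 1)) = 1 by field_simp,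
        Real.rpow_one]
    rw [sum_congr rfl this, sum_const, nsmul_eq_mul]
    have hr0 : (r α : ℝ) ≠ 0 := by have := hr α hα; positivity
    change (r α : ℝ) * _ = _
    field_simp
  rw [← hsum]
  refine sum_piFinset_rpow_le_prod (fun b => multiIdx n (κ b)) κ hκ m hm a ha
    (fun b γ => ∑ β ∈ multiIdx n (m - κ b), ‖c (β + γ)‖ ^ 2) fun b γ hγ => ?_
  have ha2 : ∀ x ∈ Γ, a x ^ 2 ≤ ‖c (∑ b, x b)‖ ^ 2 * (r (∑ b, x b) : ℝ)⁻¹ := by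
    intro x hx
    have hr1 : (1 : ℝ) ≤ r (∑ b, x b) := by exact_mod_cast hr _ (hmaps x hx)
    simp only [a]
    rw [mul_pow]
    refine mul_le_mul_of_nonneg_left ?_ (sq_nonneg _)
    rw [← Real.rpow_natCast, ← Real.rpow_mul (by positivity)]
    refine (Real.rpow_le_rpow_of_exponent_ge (by positivity) (inv_le_one_of_one_le₀ hr1)
      (show 1 ≤ ((m : ℝ) + 1) / (2 * (m : ℝ)) * ((2 : ℕ) : ℝ) from ?_)).trans_eq (Real.rpow_one _)
    push_cast
    rw [show ((m : ℝ) + 1) / (2 * (m : ℝ)) * 2 = 1 + 1 / m by field_simp]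
    linarith [show 0 ≤ 1 / (m : ℝ) by positivity]
  have hb : ∀ x ∈ Γ.filter (fun x => x b = γ), ∑ d ∈ univ.erase b, x d ∈ multiIdx n (m - κ b) := by
    intro x hx
    have := sum_mem_multiIdx (univ.erase b) (κ := κ)
      fun d _ => Fintype.mem_piFinset.1 (mem_filter.1 hx).1 d
    rwa [← hm, ← add_sum_erase univ κ (mem_univ b), Nat.add_sub_cancel_left]
  have hsplit : ∀ x : ι → Fin n →₀ ℕ, ∑ d, x d = ∑ d ∈ univ.erase b, x d + x b := fun x =>
    (sum_erase_add univ x (mem_univ b)).symm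
  refine (sum_le_sum fun x hx => ha2 x (mem_filter.1 hx).1).trans ?_
  rw [← sum_fiberwise_of_maps_to hb]
  refine sum_le_sum fun β hβ => ?_
  have hβγ : β + γ ∈ multiIdx n m := by
    have := add_mem_multiIdx hβ hγ
    rwa [Nat.sub_add_cancel (hm ▸ single_le_sum (f := κ) (fun _ _ => Nat.zero_le _)
      (mem_univ b))] at this
  have hterm : ∀ x ∈ (Γ.filter (fun x => x b = γ)).filter
      (fun x => ∑ d ∈ univ.erase b, x d = β), ‖c (∑ d, x d)‖ ^ 2 * (r (∑ d, x d) : ℝ)⁻¹ =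
      ‖c (β + γ)‖ ^ 2 * (r (β + γ) : ℝ)⁻¹ := by
    intro x hx
    rw [hsplit, (mem_filter.1 hx).2, (mem_filter.1 (mem_filter.1 hx).1).2]
  rw [sum_congr rfl hterm, sum_const, nsmul_eq_mul]
  have hcard : #((Γ.filter (fun x => x b = γ)).filter
      (fun x => ∑ d ∈ univ.erase b, x d = β)) ≤ r (β + γ) := by
    refine card_le_card fun x hx => ?_
    have h1 := mem_filter.1 hx
    have h2 := mem_filter.1 h1.1
    exact mem_filter.2 ⟨h2.1, by rw [hsplit, h1.2, h2.2]⟩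
  have hr0 : (0 : ℝ) < r (β + γ) := by exact_mod_cast hr _ hβγ
  calc _ ≤ (r (β + γ) : ℝ) * (‖c (β + γ)‖ ^ 2 * (r (β + γ) : ℝ)⁻¹) := by
        refine mul_le_mul_of_nonneg_right ?_ (by positivity)
        exact_mod_cast hcard
    _ = _ := by field_simp

/-! ### Recursive bounds for the constants -/

/-- Admissible constants in the degrees `κ b` give one in the degree `m = ∑ b, κ b`. -/
theorem mem_polConstants_of_blocks {ι : Type*} [Fintype ι] [DecidableEq ι] {m : ℕ} (hm1 : 1 ≤ m)
    (κ : ι → ℕ) (hκ : ∀ b, 1 ≤ κ b) (hm : ∑ b, κ b = m) (D : ι → ℝ)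
    (hD : ∀ b, D b ∈ polConstants (κ b)) {K : ℝ} (hK0 : 0 ≤ K)
    (hK : ∀ b, 2 ^ ((m : ℝ) / κ b) * D b * Real.exp 1 * (m : ℝ) ^ κ b ≤ K) :
    K ∈ polConstants m := by
  intro n hn P hP
  have hm0 : (0 : ℝ) < m := by exact_mod_cast hm1
  have hN := polydiskNorm_nonneg P
  have hq0 : 0 < 2 * (m : ℝ) / ((m : ℝ) + 1) := by positivity
  rw [← Real.rpow_le_rpow_iff (coeffNorm_nonneg m P) (mul_nonneg hK0 hN) hq0, coeffNorm_rpow hm1]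
  refine (sum_coeff_rpow_le_prod hm1 κ hκ hm fun α => MvPolynomial.coeff α P).trans ?_
  have hb : ∀ b ∈ (univ : Finset ι), (∑ γ ∈ multiIdx n (κ b),
      (∑ β ∈ multiIdx n (m - κ b), ‖MvPolynomial.coeff (β + γ) P‖ ^ 2) ^
        ((κ b : ℝ) / ((κ b : ℝ) + 1))) ^ (((κ b : ℝ) + 1) / ((m : ℝ) + 1)) ≤
      (K * polydiskNorm P) ^ (2 * (κ b : ℝ) / ((m : ℝ) + 1)) := by
    intro b _
    have hD0 : 0 ≤ D b := zero_le_one.trans (polConstants_one_le (hκ b) (hD b))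
    have hkm : κ b ≤ m := hm ▸ single_le_sum (f := κ) (fun _ _ => Nat.zero_le _) (mem_univ b)
    have h1 := (sum_block_rpow_le hn (hκ b) hkm hP (hD b)).trans
      (Real.rpow_le_rpow (by positivity) (mul_le_mul_of_nonneg_right (hK b) hN) (by positivity))
    refine (Real.rpow_le_rpow (sum_nonneg fun _ _ => Real.rpow_nonneg
      (sum_nonneg fun _ _ => sq_nonneg _) _) h1 (by positivity)).trans (le_of_eq ?_)
    rw [← Real.rpow_mul (mul_nonneg hK0 hN)]
    congr 1
    field_simp
  refine (prod_le_prod (fun b _ => Real.rpow_nonneg (sum_nonneg fun _ _ => Real.rpow_nonneg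
      (sum_nonneg fun _ _ => sq_nonneg _) _) _) hb).trans (le_of_eq ?_)
  rw [← Real.rpow_sum_of_nonneg (mul_nonneg hK0 hN) fun b _ => by positivity, ← sum_div, ← mul_sum]
  congr 3
  exact_mod_cast hm

/-- A linear form attains the sum of the moduli of its coefficients on the torus. -/
theorem one_mem_polConstants_one : 1 ∈ polConstants 1 := by
  intro n _ P hP
  -- The phases that make all terms of `P` nonnegative; `0 / 0 = 0` covers vanishing coefficients.
  let z : Fin n → ℂ := fun i =>
    (‖MvPolynomial.coeff (Finsupp.single i 1) P‖ : ℂ) / MvPolynomial.coeff (Finsupp.single i 1) P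
  have hz : ∀ i, ‖z i‖ ≤ 1 := fun i => by
    simp only [z, norm_div, Complex.norm_real, norm_norm]
    exact div_self_le_one _
  have hterm : ∀ α ∈ multiIdx n 1, MvPolynomial.coeff α P * mon z α =
      (‖MvPolynomial.coeff α P‖ : ℂ) := by
    intro α hα
    obtain ⟨i, rfl⟩ : ∃ i, α = Finsupp.single i 1 := by
      have h0 : ∑ i, α i ≠ 0 := by rw [mem_multiIdx.1 hα]; exact one_ne_zero
      obtain ⟨i, -, hi⟩ := exists_ne_zero_of_sum_ne_zero h0
      refine ⟨i, ?_⟩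
      have hle : Finsupp.single i 1 ≤ α := by
        rw [Finsupp.single_le_iff]; omega
      obtain ⟨δ, rfl⟩ := exists_add_of_le hle
      have h1 := mem_multiIdx.1 hα
      simp only [Finsupp.coe_add, Pi.add_apply, sum_add_distrib, Finsupp.single_apply,
        sum_ite_eq, mem_univ, if_true] at h1
      have h2 : ∑ i, δ i = 0 := by omega
      have : δ = 0 := by
        ext j
        exact sum_eq_zero_iff.1 h2 j (mem_univ j)
      rw [this, add_zero]
    have hmon : mon z (Finsupp.single i 1) = z i := by
      rw [mon, prod_eq_single i]
      · simp
      · intro j _ hj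
        simp [Finsupp.single_eq_of_ne hj]
      · simp
    rw [hmon]
    simp only [z]
    by_cases h : MvPolynomial.coeff (Finsupp.single i 1) P = 0
    · simp [h]
    · field_simp
  have he := norm_eval_le hP zero_le_one hz
  rw [eval_eq_sum_multiIdx hP, sum_congr rfl hterm, ← Complex.ofReal_sum, Complex.norm_real,
    Real.norm_of_nonneg (sum_nonneg fun _ _ => norm_nonneg _)] at he
  have hc := coeffNorm_rpow le_rfl P
  norm_num at hc he
  rw [one_mul, hc]
  exact he

theorem polConstants_nonempty {m : ℕ} (hm : 1 ≤ m) : (polConstants m).Nonempty := by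
  -- All blocks have length one.
  refine ⟨2 ^ (m : ℝ) * Real.exp 1 * m, mem_polConstants_of_blocks (ι := Fin m) hm (fun _ => 1)
    (fun _ => le_rfl) (by simp) (fun _ => 1) (fun _ => one_mem_polConstants_one) (by positivity)
    fun b => ?_⟩
  simp

theorem isLeast_bPol {m : ℕ} (hm : 1 ≤ m) : IsLeast (polConstants m) (bPol m) := by
  have hbdd : BddBelow (polConstants m) := ⟨1, fun D hD => polConstants_one_le hm hD⟩
  have hcl : IsClosed (polConstants m) := by
    have : polConstants m = ⋂ (n : ℕ) (_ : 1 ≤ n) (P : MvPolynomial (Fin n) ℂ)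
        (_ : P.IsHomogeneous m), {D : ℝ | coeffNorm m P ≤ D * polydiskNorm P} := by
      ext D; simp [polConstants]
    rw [this]
    refine isClosed_iInter fun n => isClosed_iInter fun _ => isClosed_iInter fun P =>
      isClosed_iInter fun _ => isClosed_le continuous_const (by fun_prop)
  exact ⟨hcl.csInf_mem (polConstants_nonempty hm) hbdd, fun D hD => csInf_le hbdd hD⟩

/-- Cutting the degree into blocks of lengths in `[k, 2k)` bounds the best constant in degree `m` by
`2^{m/k}` times a polynomial in `m`. -/
theorem bPol_le_of_block_length {k m : ℕ} (hk : 1 ≤ k) (hkm : k ≤ m) {M : ℝ}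
    (hM : ∀ j, 1 ≤ j → j < 2 * k → bPol j ≤ M) :
    bPol m ≤ 2 ^ ((m : ℝ) / k) * M * Real.exp 1 * (m : ℝ) ^ (2 * k) := by
  have hm1 : 1 ≤ m := hk.trans hkm
  have hm1R : (1 : ℝ) ≤ m := by exact_mod_cast hm1
  have hk0 : (0 : ℝ) < k := by exact_mod_cast hk
  have hM1 : 1 ≤ M := (polConstants_one_le hk (isLeast_bPol hk).1).trans (hM k hk (by omega))
  have hmod := Nat.mod_lt m (show 0 < k by omega)
  -- One block has size `k + m % k`, the others have size `k`.
  let κ : Option (Fin (m / k - 1)) → ℕ := fun o => o.elim (k + m % k) fun _ => k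
  have hκk : ∀ b, k ≤ κ b ∧ κ b < 2 * k := by
    rintro (_ | b) <;> simp only [κ, Option.elim] <;> omega
  have hκ : ∀ b, 1 ≤ κ b := fun b => hk.trans (hκk b).1
  have hsum : ∑ b, κ b = m := by
    rw [Fintype.sum_option]
    simp only [κ, Option.elim, sum_const, card_univ, Fintype.card_fin, smul_eq_mul]
    have h1 : 1 ≤ m / k := (Nat.one_le_div_iff (by omega)).2 hkm
    have h2 := Nat.div_add_mod' m k
    obtain ⟨q, hq⟩ := Nat.exists_eq_add_of_le' h1
    rw [hq] at h2 ⊢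
    rw [Nat.add_sub_cancel]
    linarith
  refine (isLeast_bPol hm1).2 (mem_polConstants_of_blocks hm1 κ hκ hsum (fun b => bPol (κ b))
    (fun b => (isLeast_bPol (hκ b)).1) (by positivity) fun b => ?_)
  have hb0 : 0 ≤ bPol (κ b) := zero_le_one.trans (polConstants_one_le (hκ b) (isLeast_bPol (hκ b)).1)
  have h1 : (2 : ℝ) ^ ((m : ℝ) / κ b) ≤ 2 ^ ((m : ℝ) / k) := by
    refine Real.rpow_le_rpow_of_exponent_le (by norm_num) ?_
    gcongr
    exact (hκk b).1
  have h2 : (m : ℝ) ^ κ b ≤ (m : ℝ) ^ (2 * k) := pow_le_pow_right₀ hm1R (hκk b).2.le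
  have h3 := hM _ (hκ b) (hκk b).2
  gcongr

end BohnenblustHille

/-- The first conjunct says that the best constant exists, that is, that `bPol m` is itself
an admissible constant (so that the infimum is not taken over the empty set). -/
theorem mainTheorem3 (ε : ℝ) (hε : 0 < ε) :
    ∃ κ : ℝ, 0 < κ ∧ ∀ m : ℕ, 1 ≤ m →
      IsLeast (BohnenblustHille.polConstants m) (BohnenblustHille.bPol m) ∧
        BohnenblustHille.bPol m ≤ κ * (1 + ε) ^ m := by
  -- The block length `k` is chosen such that `2 ^ (1 / k) < 1 + ε`.
  obtain ⟨k, hk⟩ := pow_unbounded_of_one_lt (2 : ℝ) (show 1 < 1 + ε by linarith)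
  have hk1 : 1 ≤ k := by
    by_contra h
    have : k = 0 := by omega
    norm_num [this] at hk
  have hk0 : (0 : ℝ) < k := by exact_mod_cast hk1
  have hε1 : 0 < 1 + ε := by linarith
  set a : ℝ := 2 ^ (1 / (k : ℝ)) with ha
  have ha0 : 0 < a := Real.rpow_pos_of_pos (by norm_num) _
  have ha1 : a < 1 + ε := by
    refine lt_of_pow_lt_pow_left₀ k hε1.le ?_
    rwa [ha, ← Real.rpow_natCast, ← Real.rpow_mul (by norm_num), one_div_mul_cancel hk0.ne',
      Real.rpow_one]
  have hbpos : ∀ j, 1 ≤ j → 1 ≤ BohnenblustHille.bPol j := fun j hj =>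
    BohnenblustHille.polConstants_one_le hj (BohnenblustHille.isLeast_bPol hj).1
  set M : ℝ := ∑ j ∈ Finset.range (2 * k), |BohnenblustHille.bPol j| with hMdef
  have hM : ∀ j, 1 ≤ j → j < 2 * k → BohnenblustHille.bPol j ≤ M := fun j _ hj =>
    (le_abs_self _).trans (Finset.single_le_sum (f := fun j => |BohnenblustHille.bPol j|)
      (fun _ _ => abs_nonneg _) (Finset.mem_range.2 hj))
  have hM1 : 1 ≤ M := (hbpos k hk1).trans (hM k hk1 (by omega))
  obtain ⟨B, hB⟩ : BddAbove (Set.range fun m : ℕ => (m : ℝ) ^ (2 * k) * (a / (1 + ε)) ^ m) :=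
    (tendsto_pow_const_mul_const_pow_of_abs_lt_one (2 * k) (by
      rw [abs_of_pos (by positivity), div_lt_one hε1]; exact ha1)).bddAbove_range
  have hB' : ∀ m : ℕ, (m : ℝ) ^ (2 * k) * a ^ m ≤ B * (1 + ε) ^ m := fun m => by
    have := hB ⟨m, rfl⟩
    simp only [div_pow] at this
    rwa [← mul_div_assoc, div_le_iff₀ (by positivity)] at this
  have hB0 : 0 < B := lt_of_lt_of_le (by positivity) (hB ⟨1, rfl⟩)
  refine ⟨M + M * Real.exp 1 * B, by positivity, fun m hm => ⟨BohnenblustHille.isLeast_bPol hm, ?_⟩⟩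
  rw [add_mul]
  rcases lt_or_ge m k with h | h
  · have h1 : M * 1 ≤ M * (1 + ε) ^ m :=
      mul_le_mul_of_nonneg_left (one_le_pow₀ (by linarith)) (by linarith)
    have h2 : 0 ≤ M * Real.exp 1 * B * (1 + ε) ^ m := by positivity
    linarith [hM m hm (by omega)]
  · have h1 := BohnenblustHille.bPol_le_of_block_length hk1 h hM
    have h2 : (2 : ℝ) ^ ((m : ℝ) / k) = a ^ m := by
      rw [ha, ← Real.rpow_natCast, ← Real.rpow_mul (by norm_num)]
      congr 1
      ring
    rw [h2] at h1
    have h3 : M * Real.exp 1 * ((m : ℝ) ^ (2 * k) * a ^ m) ≤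
        M * Real.exp 1 * (B * (1 + ε) ^ m) := mul_le_mul_of_nonneg_left (hB' m) (by positivity)
    have h4 : 0 ≤ M * (1 + ε) ^ m := by positivity
    linarith
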